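/- There are constants $C$, $N$ and $x_0>0$ such that the following holds for all integers $m\ge n\ge N$ with $n\ge 1$. Let $A$ be an $m\times n$ real random matrix whose entries are independent and identically distributed with the Cauchy density $f(x)=\frac{1}{\pi(1+x^2)}$, and let $\lambda_1\ge\lambda_2\ge\dots\ge\lambda_n$ be the eigenvalues of $A^tA$. Then $$\Pr\left(\frac{\lambda_1}{n^2m^2}>x\right)<C\,x^{-1/2}\qquad\text{for all } x\ge x_0 .$$ -/

import Mathlib

open MeasureTheory ProbabilityTheory

/-- The Gram matrix `Aᵀ A` of a real rectangular matrix is symmetric. -/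
theorem gram_isHermitian {m n : ℕ} (A : Matrix (Fin m) (Fin n) ℝ) :
    (A.transpose * A).IsHermitian := by
  simpa using Matrix.isHermitian_conjTranspose_mul_self A

/-- The eigenvalues `λ₁ ≥ λ₂ ≥ ⋯ ≥ λₙ` of the `n × n` matrix `Aᵀ A`, listed with multiplicity in
decreasing order; the index is shifted by one, so that `gramEigenvalue A 0` is `λ₁`. -/
noncomputable def gramEigenvalue {m n : ℕ} (A : Matrix (Fin m) (Fin n) ℝ) (k : Fin n) : ℝ :=
  (gram_isHermitian A).eigenvalues₀ (Fin.cast (Fintype.card_fin n).symm k)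

/-- The entries of the `m × n` random matrix `A` are independent and identically distributed,
with the standard Cauchy density `1 / (π (1 + x ^ 2))`. -/
structure IsCauchyMatrix {Ω : Type*} [MeasurableSpace Ω] {m n : ℕ}
    (A : Ω → Matrix (Fin m) (Fin n) ℝ) (μ : Measure Ω) : Prop where
  indep : iIndepFun (fun (p : Fin m × Fin n) (ω : Ω) => A ω p.1 p.2) μ
  law : ∀ (j : Fin m) (k : Fin n), HasLaw (fun ω => A ω j k) (cauchyMeasure 0 1) μ

open scoped NNReal ENNReal

/-! The eigenvalues of the Gram matrix are nonnegative, so `λ₁` is at most the trace, a sum of `mn`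
squared Cauchy variables. These have infinite mean, but capped at `T²` each has mean at most `2T`.
Markov's inequality for the capped sum bounds the probability that the trace exceeds `T²` by `mn ·
2T / T² = 2mn / T`; with `T = mn√x` this is `2 / √x`. -/

/-- The largest eigenvalue of `Aᵀ A` is at most its trace, the sum of the squared entries. -/
theorem gramEigenvalue_le_sum_sq {m n : ℕ} (A : Matrix (Fin m) (Fin n) ℝ) (k : Fin n) :
    gramEigenvalue A k ≤ ∑ p : Fin m × Fin n, A p.1 p.2 ^ 2 := by
  have htrace : (A.transpose * A).trace = ∑ p : Fin m × Fin n, A p.1 p.2 ^ 2 := by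
    rw [Fintype.sum_prod_type, Finset.sum_comm]
    simp [Matrix.trace, Matrix.mul_apply, pow_two]
  have hpos : (A.transpose * A).PosSemidef := by
    simpa using Matrix.posSemidef_conjTranspose_mul_self A
  let e : Fin (Fintype.card (Fin n)) ≃ Fin n := Fintype.equivOfCardEq (Fintype.card_fin _)
  have hk : gramEigenvalue A k =
      (gram_isHermitian A).eigenvalues (e (Fin.cast (Fintype.card_fin n).symm k)) := by
    simp [gramEigenvalue, Matrix.IsHermitian.eigenvalues, e]
  rw [hk, ← htrace, (gram_isHermitian A).trace_eq_sum_eigenvalues]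
  exact Finset.single_le_sum (f := fun i => (gram_isHermitian A).eigenvalues i)
    (fun i _ => hpos.eigenvalues_nonneg i) (Finset.mem_univ _)

/-- The truncated second moment of the standard Cauchy law grows at most linearly in the
truncation level. -/
theorem lintegral_min_sq_cauchyMeasure_le {T : ℝ≥0} (hT : 1 ≤ T) :
    ∫⁻ a, ENNReal.ofReal (min (a ^ 2) ((T : ℝ) ^ 2)) ∂(cauchyMeasure 0 1) ≤ 2 * T := by
  have hT0 : T ≠ 0 := (zero_lt_one.trans_le hT).ne'
  have hT1 : (1 : ℝ) ≤ T := by exact_mod_cast hT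
  rw [cauchyMeasure_of_scale_ne_zero 0 one_ne_zero,
    lintegral_withDensity_eq_lintegral_mul _ (by fun_prop) (by fun_prop)]
  calc ∫⁻ a, (cauchyPDF 0 1 * fun a => ENNReal.ofReal (min (a ^ 2) ((T : ℝ) ^ 2))) a
      -- Pointwise domination by a multiple of the Cauchy density of scale `T`, whose total mass is
      -- 1, so no integral has to be computed.
      ≤ ∫⁻ a, 2 * T * cauchyPDF 0 T a := by
        refine lintegral_mono fun a => ?_
        have h2 : (2 * T : ℝ≥0∞) = ENNReal.ofReal (2 * T) := by
          rw [ENNReal.ofReal_mul zero_le_two]; simp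
        rw [Pi.mul_apply, cauchyPDF_def, cauchyPDF_def, h2,
          ← ENNReal.ofReal_mul (cauchyPDF_pos 0 one_ne_zero a).le,
          ← ENNReal.ofReal_mul (by positivity)]
        apply ENNReal.ofReal_le_ofReal
        simp only [cauchyPDFReal_def, sub_zero, NNReal.coe_one, mul_one, one_pow]
        have key : (a ^ 2 + 1)⁻¹ * min (a ^ 2) ((T : ℝ) ^ 2) ≤
            2 * T ^ 2 * (a ^ 2 + (T : ℝ) ^ 2)⁻¹ := by
          rw [inv_mul_eq_div, ← div_eq_mul_inv, div_le_div_iff₀ (by positivity) (by positivity)]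
          rcases le_total (a ^ 2) ((T : ℝ) ^ 2) with h | h
          · rw [min_eq_left h]
            nlinarith [mul_le_mul_of_nonneg_left h (sq_nonneg a), sq_nonneg (T : ℝ)]
          · rw [min_eq_right h]
            nlinarith [mul_le_mul_of_nonneg_left h (sq_nonneg (T : ℝ)), sq_nonneg (T : ℝ)]
        calc _ = Real.pi⁻¹ * ((a ^ 2 + 1)⁻¹ * min (a ^ 2) ((T : ℝ) ^ 2)) := by ring
          _ ≤ Real.pi⁻¹ * (2 * T ^ 2 * (a ^ 2 + (T : ℝ) ^ 2)⁻¹) := by gcongr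
          _ = _ := by ring
    _ = 2 * T := by
        rw [lintegral_const_mul _ (by fun_prop), lintegral_cauchyPDF_eq_one 0 hT0, mul_one]

/-- Either a single term already reaches the cap `c`, or no term is truncated. This lets the cap
pass from the sum to each summand. -/
theorem min_sum_le_sum_min {ι : Type*} (s : Finset ι) {f : ι → ℝ} {c : ℝ} (hf : ∀ i, 0 ≤ f i)
    (hc : 0 ≤ c) : min (∑ i ∈ s, f i) c ≤ ∑ i ∈ s, min (f i) c := by
  have hmin : ∀ i ∈ s, 0 ≤ min (f i) c := fun i _ => le_min (hf i) hc
  by_cases h : ∃ i ∈ s, c ≤ f i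
  · obtain ⟨i, hi, hci⟩ := h
    calc min (∑ i ∈ s, f i) c ≤ min (f i) c := by rw [min_eq_right hci]; exact min_le_right _ _
      _ ≤ _ := Finset.single_le_sum (f := fun i => min (f i) c) hmin hi
  · push Not at h
    rw [Finset.sum_congr rfl fun i hi => min_eq_left (h i hi).le]
    exact min_le_left _ _

/-- Tail bound for a sum of squares of (possibly dependent) standard Cauchy variables. -/
theorem measure_sq_lt_sum_sq_le {Ω ι : Type*} [MeasurableSpace Ω] [Fintype ι] {μ : Measure Ω}
    {X : ι → Ω → ℝ} (hX : ∀ i, HasLaw (X i) (cauchyMeasure 0 1) μ) {T : ℝ≥0} (hT : 1 ≤ T) :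
    μ {ω | (T : ℝ) ^ 2 < ∑ i, X i ω ^ 2} ≤ ENNReal.ofReal (2 * Fintype.card ι / T) := by
  have hT0 : (0 : ℝ) < T := by exact_mod_cast zero_lt_one.trans_le hT
  have hmeas (i : ι) : AEMeasurable
      (fun ω => ENNReal.ofReal (min (X i ω ^ 2) ((T : ℝ) ^ 2))) μ := by
    have := (hX i).aemeasurable
    fun_prop
  calc μ {ω | (T : ℝ) ^ 2 < ∑ i, X i ω ^ 2}
      ≤ μ {ω | ENNReal.ofReal ((T : ℝ) ^ 2) ≤
          ∑ i, ENNReal.ofReal (min (X i ω ^ 2) ((T : ℝ) ^ 2))} := by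
        refine measure_mono fun ω (hω : (T : ℝ) ^ 2 < _) => ?_
        rw [Set.mem_ofPred_eq, ← ENNReal.ofReal_sum_of_nonneg fun i _ => by positivity]
        apply ENNReal.ofReal_le_ofReal
        rw [← min_eq_right hω.le]
        simpa [min_eq_right hω.le] using min_sum_le_sum_min Finset.univ
          (f := fun i => X i ω ^ 2) (fun i => sq_nonneg _) (sq_nonneg (T : ℝ))
    _ ≤ (∫⁻ ω, ∑ i, ENNReal.ofReal (min (X i ω ^ 2) ((T : ℝ) ^ 2)) ∂μ) /
          ENNReal.ofReal ((T : ℝ) ^ 2) :=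
        meas_ge_le_lintegral_div (by fun_prop)
          (ENNReal.ofReal_pos.2 (pow_pos hT0 2)).ne' ENNReal.ofReal_ne_top
    _ ≤ (∑ _i : ι, ENNReal.ofReal (2 * T)) / ENNReal.ofReal ((T : ℝ) ^ 2) := by
        rw [lintegral_finsetSum' _ fun i _ => hmeas i]
        gcongr with i
        rw [(hX i).lintegral_comp
          (f := fun a => ENNReal.ofReal (min (a ^ 2) ((T : ℝ) ^ 2))) (by fun_prop),
          ENNReal.ofReal_mul zero_le_two]
        simpa using lintegral_min_sq_cauchyMeasure_le hT
    _ = ENNReal.ofReal (2 * Fintype.card ι / T) := by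
        rw [← ENNReal.ofReal_sum_of_nonneg fun i _ => by positivity,
          ← ENNReal.ofReal_div_of_pos (by positivity)]
        congr 1
        simp only [Finset.sum_const, Finset.card_univ, nsmul_eq_mul]
        field_simp

theorem corollary2 :
    ∃ (C : ℝ) (N : ℕ) (x₀ : ℝ), 0 < x₀ ∧
      ∀ (n m : ℕ) (hn : 0 < n), N ≤ n → n ≤ m →
        ∀ {Ω : Type*} [MeasurableSpace Ω] (μ : Measure Ω) [IsProbabilityMeasure μ]
          (A : Ω → Matrix (Fin m) (Fin n) ℝ), IsCauchyMatrix A μ →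
          ∀ x : ℝ, x₀ ≤ x →
            μ.real {ω | x < gramEigenvalue (A ω) ⟨0, hn⟩ / ((n : ℝ) ^ 2 * (m : ℝ) ^ 2)} <
              C * x ^ (-(1 / 2 : ℝ)) := by
  -- The bound obtained is `2 / √x`; any `C > 2` makes it strict. `x₀ = 1` ensures `T ≥ 1`.
  refine ⟨3, 0, 1, one_pos, fun n m hn _ hnm Ω _ μ _ A hA x hx => ?_⟩
  have hx0 : 0 < x := one_pos.trans_le hx
  have hn1 : (1 : ℝ) ≤ n := by exact_mod_cast hn
  have hm1 : (1 : ℝ) ≤ m := by exact_mod_cast hn.trans_le hnm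
  have hsqrt : 1 ≤ √x := Real.one_le_sqrt.2 hx
  have hT1 : 1 ≤ (m : ℝ) * n * √x :=
    one_le_mul_of_one_le_of_one_le (one_le_mul_of_one_le_of_one_le hm1 hn1) hsqrt
  let T : ℝ≥0 := ⟨(m : ℝ) * n * √x, by positivity⟩
  have hTval : (T : ℝ) = (m : ℝ) * n * √x := rfl
  have hT : 1 ≤ T := hT1
  have hsub : {ω | x < gramEigenvalue (A ω) ⟨0, hn⟩ / ((n : ℝ) ^ 2 * (m : ℝ) ^ 2)} ⊆
      {ω | (T : ℝ) ^ 2 < ∑ p : Fin m × Fin n, A ω p.1 p.2 ^ 2} := by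
    intro ω hω
    rw [Set.mem_ofPred_eq, lt_div_iff₀ (by positivity)] at hω
    refine lt_of_eq_of_lt ?_ (hω.trans_le (gramEigenvalue_le_sum_sq _ _))
    rw [hTval, mul_pow, Real.sq_sqrt hx0.le]
    ring
  have hbound := (measure_mono hsub).trans
    (measure_sq_lt_sum_sq_le (fun p : Fin m × Fin n => hA.law p.1 p.2) hT)
  have hrpow : x ^ (-(1 / 2 : ℝ)) = (√x)⁻¹ := by
    rw [Real.rpow_neg hx0.le, Real.sqrt_eq_rpow]
  calc μ.real _ ≤ 2 * Fintype.card (Fin m × Fin n) / T :=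
        ENNReal.toReal_le_of_le_ofReal (by positivity) hbound
    _ = 2 * (√x)⁻¹ := by
        rw [hTval]
        simp only [Fintype.card_prod, Fintype.card_fin, Nat.cast_mul]
        field_simp
    _ < 3 * x ^ (-(1 / 2 : ℝ)) := by
        rw [hrpow]
        have : 0 < (√x)⁻¹ := by positivity
        linarith
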